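/- Let $\tau$ be in the upper half plane, $\Lambda=\mathbb Z+\tau\mathbb Z$, and let $E=\mathbb C/\Lambda$ be the corresponding complex elliptic curve. Let $m,n$ be positive integers and endow $E^2=E\times E$ with the product polarization $p_1^*(m\Theta)+p_2^*(n\Theta)$, where $\Theta$ is the principal polarization of $E$; its alternating form on $\Lambda\times\Lambda$ is the imaginary part of the Hermitian form $(m z_1\overline{z_1'}+n z_2\overline{z_2'})/\operatorname{Im}\tau$. An elliptic curve in $E^2$ is a one-dimensional complex subtorus, i.e. the image of a complex line $L\subset\mathbb C^2$ such that $L\cap(\Lambda\times\Lambda)$ is free of rank $2$. Its degree is its intersection number with the polarization, i.e. the absolute value of the alternating form on a $\mathbb Z$-basis of $L\cap(\Lambda\times\Lambda)$. For real $t$ let $N_{E^2}(t)$ be the number of elliptic curves in $E^2$ of degree $\le t$. **Proposition.** For every real $t$ the number $N_{E^2}(t)$ is finite, and there are a constant $C$ and a function $q$ with $q(t)=O(t^2)$ as $t\to\infty$ such that $$N_{E^2}(t)\le C\,t^3+q(t)\qquad\text{for all real } t\ge 0,$$ given explicitly as follows. (i) If $E$ has no complex multiplication, then $C=0$ and $$q(t)=A_0\,t+\tfrac12L_0\,t^{1/2}+1,$$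 where $A_0=\pi/\sqrt{mn}$ and $L_0$ are the area and the length of the boundary of the region $mx^2+ny^2\le 1$ in $\mathbb R^2$. (ii) If $E$ has complex multiplication (that is, $\operatorname{End}(E)\ne\mathbb Z$), then there are integers $u,v,w$ with $w>0$, $\gcd(u,v,w)=1$, $u^2-4vw<0$ and $w\tau^2+u\tau+v=0$ such that the following holds. Put $Q(x,y)=x^2+uxy+vwy^2$, let $A=\pi\,(vw-\tfrac14u^2)^{-1/2}$ and $L$ be the area and the length of the boundary of the region $Q\le 1$ in $\mathbb R^2$, and let $\mu=\min\{m,n\}$. Then $$C=\frac{A}{6\mu^3},\qquad q(t)=\frac{\pi L}{16\,\mu^2}\,t^2+\frac{t}{\mu}+\frac{L}{12},$$ and more precisely, for every real $t\ge\mu$, with $t'=\lfloor t/\mu\rfloor$, $$N_{E^2}(t)\le A\Big(\frac16{t'}^3-\frac16t'\Big)+\frac L2\Big(\frac\pi8{t'}^2-\frac{t'-2}{6t'}\Big)+t'.$$ -/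

import Mathlib

open Filter Asymptotics
open scoped UpperHalfPlane

noncomputable section

namespace EllipticSquare

/-- The period lattice `ℤ + τℤ` of the elliptic curve `E`. -/
def lattice (τ : ℍ) : AddSubgroup ℂ :=
  AddSubgroup.closure {1, (τ : ℂ)}

/-- The complex elliptic curve `E = ℂ / (ℤ + τℤ)`. -/
abbrev Curve (τ : ℍ) : Type := ℂ ⧸ lattice τ

/-- `E` has complex multiplication: `End(E) = {z ∈ ℂ | zΛ ⊆ Λ}` is strictly larger than `ℤ`. -/
def HasCM (τ : ℍ) : Prop :=
  ∃ z : ℂ, (∀ x ∈ lattice τ, z * x ∈ lattice τ) ∧ ∀ k : ℤ, z ≠ k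

/-- The period lattice `Λ × Λ ⊆ ℂ²` of `E²`. -/
def lattice2 (τ : ℍ) : AddSubgroup (ℂ × ℂ) :=
  (lattice τ).prod (lattice τ)

/-- The uniformization `ℂ² → E × E`. -/
def proj (τ : ℍ) : ℂ × ℂ →+ Curve τ × Curve τ :=
  AddMonoidHom.prodMap (QuotientAddGroup.mk' (lattice τ)) (QuotientAddGroup.mk' (lattice τ))

/-- `F` is an elliptic curve in `E²`, i.e. a one-dimensional complex subtorus: it is the image of
a complex line `L` of `ℂ²` such that the group of periods `L ∩ (Λ × Λ)` is free of rank two. -/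
def IsEllipticCurve (τ : ℍ) (F : AddSubgroup (Curve τ × Curve τ)) : Prop :=
  ∃ L : Submodule ℂ (ℂ × ℂ), Module.finrank ℂ L = 1 ∧
    Nonempty (Module.Basis (Fin 2) ℤ ↥(L.toAddSubgroup ⊓ lattice2 τ)) ∧
    F = L.toAddSubgroup.map (proj τ)

/-- The tangent space at the origin of a complex subtorus `F` of `E²`, as a subspace of `ℂ²`:
the vectors whose complex one-parameter subgroup lies in `F`. -/
def tangentSpace (τ : ℍ) (F : AddSubgroup (Curve τ × Curve τ)) : Submodule ℂ (ℂ × ℂ) where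
  carrier := {v | ∀ z : ℂ, proj τ (z • v) ∈ F}
  add_mem' := by
    intro v w hv hw z
    rw [smul_add, map_add]
    exact F.add_mem (hv z) (hw z)
  zero_mem' := by
    intro z
    rw [smul_zero, map_zero]
    exact F.zero_mem
  smul_mem' := by
    intro c v hv z
    rw [smul_smul]
    exact hv (z * c)

/-- The lattice of periods of `F`, namely `H₁(F, ℤ)` inside `H₁(E², ℤ) = Λ × Λ`. -/
def periods (τ : ℍ) (F : AddSubgroup (Curve τ × Curve τ)) : AddSubgroup (ℂ × ℂ) :=
  (tangentSpace τ F).toAddSubgroup ⊓ lattice2 τ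

/-- The alternating form (first Chern class) of the product polarization
`p₁^*(mΘ) + p₂^*(nΘ)` on `E²`, where `Θ` is the principal polarization of `E`: it is the
imaginary part of the Hermitian form `(m z₁ conj(z₁') + n z₂ conj(z₂')) / Im τ`. -/
def polarization (τ : ℍ) (m n : ℕ) (x y : ℂ × ℂ) : ℝ :=
  (m * (x.1 * starRingEnd ℂ y.1) + n * (x.2 * starRingEnd ℂ y.2)).im / τ.im

open Classical in
/-- The degree `F · (p₁^*(mΘ) + p₂^*(nΘ))` of an elliptic curve `F` in `E²`, that is, the degree
of the induced polarization: the absolute value of the polarization form on a basis of the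
lattice of periods of `F`. -/
def degree (τ : ℍ) (m n : ℕ) (F : AddSubgroup (Curve τ × Curve τ)) : ℝ :=
  if h : Nonempty (Module.Basis (Fin 2) ℤ ↥(periods τ F)) then
    |polarization τ m n (h.some 0 : ↥(periods τ F)) (h.some 1 : ↥(periods τ F))|
  else 0

/-- The set of the elliptic curves in `E²` of degree at most `t`. -/
def curvesOfDegreeLE (τ : ℍ) (m n : ℕ) (t : ℝ) : Set (AddSubgroup (Curve τ × Curve τ)) :=
  {F | IsEllipticCurve τ F ∧ degree τ m n F ≤ t}

/-- The counting function `N_{E²}(t)`. -/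
def N (τ : ℍ) (m n : ℕ) (t : ℝ) : ℕ := (curvesOfDegreeLE τ m n t).ncard

/-- The standard parametrization, once around for `θ ∈ [0, 2π]`, of the ellipse
`a x² + b x y + c y² = 1` (with `a > 0` and `4ac - b² > 0`) in the Euclidean plane. -/
def ellipsePoint (a b c θ : ℝ) : EuclideanSpace ℝ (Fin 2) :=
  !₂[(Real.cos θ - b / √(4 * a * c - b ^ 2) * Real.sin θ) / √a,
    2 * √a / √(4 * a * c - b ^ 2) * Real.sin θ]

/-- The length of the ellipse `a x² + b x y + c y² = 1`. -/
def ellipseLength (a b c : ℝ) : ℝ :=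
  ∫ θ in (0 : ℝ)..(2 * Real.pi), ‖deriv (ellipsePoint a b c) θ‖

/-- The area of the region `a x² + b x y + c y² ≤ 1`, for `a > 0` and `4ac - b² > 0`. -/
def ellipseArea (a b c : ℝ) : ℝ := Real.pi / √(a * c - b ^ 2 / 4)

/-- `ellipsePoint` does lie on the ellipse. -/
theorem ellipsePoint_mem (a b c θ : ℝ) (ha : 0 < a) (h : 0 < 4 * a * c - b ^ 2) :
    a * ellipsePoint a b c θ 0 ^ 2 + b * ellipsePoint a b c θ 0 * ellipsePoint a b c θ 1
      + c * ellipsePoint a b c θ 1 ^ 2 = 1 := by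
  have h1 : √a ^ 2 = a := Real.sq_sqrt ha.le
  have h2 : √(4 * a * c - b ^ 2) ^ 2 = 4 * a * c - b ^ 2 := Real.sq_sqrt h.le
  have h3 : 0 < √a := Real.sqrt_pos.2 ha
  have h4 : 0 < √(4 * a * c - b ^ 2) := Real.sqrt_pos.2 h
  have h5 := Real.sin_sq_add_cos_sq θ
  simp only [ellipsePoint, PiLp.toLp_apply, Matrix.cons_val_zero, Matrix.cons_val_one]
  set s := √a
  set d := √(4 * a * c - b ^ 2)
  have hc : c = (d ^ 2 + b ^ 2) / (4 * s ^ 2) := by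
    rw [h1, h2]; field_simp; ring
  rw [hc, ← h1]
  field_simp
  linear_combination 4 * d ^ 2 * h5

theorem proj_eq_zero (τ : ℍ) (v : ℂ × ℂ) : proj τ v = 0 ↔ v ∈ lattice2 τ := by
  simp [proj, lattice2, AddSubgroup.mem_prod, Prod.ext_iff]

theorem lattice2_countable (τ : ℍ) : (lattice2 τ : Set (ℂ × ℂ)).Countable := by
  have h : (lattice τ : Set ℂ).Countable := by
    have : (lattice τ : Set ℂ) ⊆ Set.range (fun p : ℤ × ℤ => p.1 • (1 : ℂ) + p.2 • (τ : ℂ)) := by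
      intro x hx
      obtain ⟨a, b, hab⟩ := AddSubgroup.mem_closure_pair.1 hx
      exact ⟨(a, b), hab⟩
    exact (Set.countable_range _).mono this
  exact h.prod h

/-- The tangent space of the image of a complex subspace `L` is `L`. -/
theorem tangentSpace_map (τ : ℍ) (L : Submodule ℂ (ℂ × ℂ)) :
    tangentSpace τ (L.toAddSubgroup.map (proj τ)) = L := by
  apply le_antisymm
  · intro v hv
    by_contra hvL
    have key : ∀ z : ℂ, ∃ x ∈ lattice2 τ, z • v - x ∈ L := by
      intro z
      obtain ⟨l, hl, hlz⟩ := hv z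
      refine ⟨z • v - l, ?_, by simpa using hl⟩
      rw [← proj_eq_zero, map_sub, hlz, sub_self]
    choose x hx hxL using key
    have inj : Function.Injective x := by
      intro z w hzw
      by_contra hne
      apply hvL
      have h1 : (z - w) • v ∈ L := by
        have := L.sub_mem (hxL z) (hxL w)
        rw [hzw, sub_sub_sub_cancel_right, ← sub_smul] at this
        exact this
      exact (L.smul_mem_iff (sub_ne_zero.2 hne)).1 h1
    have hc : (Set.univ : Set ℂ).Countable :=
      Set.MapsTo.countable_of_injOn (f := x) (t := (lattice2 τ : Set (ℂ × ℂ)))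
        (fun z _ => hx z) (inj.injOn) (lattice2_countable τ)
    exact not_countable_complex hc
  · intro v hv z
    exact ⟨z • v, L.smul_mem z hv, rfl⟩

/-- The degree may be computed on any basis of the lattice of periods. -/
theorem degree_eq (τ : ℍ) (m n : ℕ) (F : AddSubgroup (Curve τ × Curve τ))
    (b : Module.Basis (Fin 2) ℤ ↥(periods τ F)) :
    degree τ m n F = |polarization τ m n (b 0 : ↥(periods τ F)) (b 1 : ↥(periods τ F))| := by
  have h : Nonempty (Module.Basis (Fin 2) ℤ ↥(periods τ F)) := ⟨b⟩
  rw [degree, dif_pos h]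
  generalize h.some = b'
  have hexp : ∀ i, ((b' i : ↥(periods τ F)) : ℂ × ℂ) =
      (b.toMatrix b' 0 i) • ((b 0 : ↥(periods τ F)) : ℂ × ℂ) +
      (b.toMatrix b' 1 i) • ((b 1 : ↥(periods τ F)) : ℂ × ℂ) := by
    intro i
    have := congrArg (Subtype.val) (b.sum_toMatrix_smul_self b' i)
    rw [Fin.sum_univ_two] at this
    exact this.symm
  have hdet : |(b.toMatrix b').det| = 1 := by
    apply Int.isUnit_iff_abs_eq.1
    have := b.invertibleToMatrix b'
    exact (Matrix.isUnit_iff_isUnit_det _).1 (isUnit_of_invertible _)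
  have hd : polarization τ m n (b' 0 : ↥(periods τ F)) (b' 1 : ↥(periods τ F)) =
      ((b.toMatrix b').det : ℝ) *
        polarization τ m n (b 0 : ↥(periods τ F)) (b 1 : ↥(periods τ F)) := by
    rw [hexp 0, hexp 1, Matrix.det_fin_two]
    simp only [polarization, Prod.fst_add, Prod.snd_add, Prod.smul_fst, Prod.smul_snd]
    simp only [zsmul_eq_mul, map_add, map_mul, Complex.add_im, Complex.mul_im, Complex.mul_re,
      Complex.add_re, Complex.conj_re, Complex.conj_im, Complex.intCast_re, Complex.intCast_im,
      Complex.natCast_re, Complex.natCast_im]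
    push_cast
    ring
  rw [hd, abs_mul, ← Int.cast_abs, hdet, Int.cast_one, one_mul]

end EllipticSquare

end

namespace EllipticSquare

/-! Counting curves becomes counting lattice points. Let `x`, `c • x` be a period basis of `F` with
`Im c > 0`, and put `κ = Im c / Im τ`. The numbers `dᵢ = κ |xᵢ|²` are the degrees of the two
projections `F → E`, and `z = κ x₁ x̄₂` is the endomorphism of `E` obtained by composing the dual of
the second projection with the first. Then `|z|² = d₁ d₂`, the degree of `F` is `m d₁ + n d₂`, and
the tangent line is spanned by `(d₁, z̄)` when `d₁ ≠ 0` (`IsEllipticCurve.exists_degrees`).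

Without CM, `z` is an integer, so the line has a primitive integral direction `(a, b)` with `m a² +
n b² ≤ deg F`: one counts points in one ellipse. With CM, `End(E) = ℤ + ℤwτ` carries the norm form
`Q`, and degree at most `t` forces `d₁ + d₂ ≤ k = ⌊t / μ⌋`. For each `d = d₁` one counts points with
`Q ≤ d (k - d)`, then sums over `d`.

An ellipse `Q ≤ s` contains at most `A s + (L / 2) √s + 1` lattice points
(`exists_finset_lattice_points`). This follows by slicing into rows, since the trapezoidal rule
underestimates the integral of the concave row length. The same rule bounds the sum of `√(d (k -
d))` by the area of a half disc (`sum_sqrt_mul_sub_le`). -/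

/-! ### Concavity and the trapezoidal rule -/

theorem concaveOn_sqrt_comp {S : Set ℝ} {g : ℝ → ℝ} (hg : ConcaveOn ℝ S g)
    (h0 : ∀ x ∈ S, 0 ≤ g x) : ConcaveOn ℝ S fun x => √(g x) := by
  refine ⟨hg.1, fun x hx y hy a b ha hb hab => ?_⟩
  refine le_trans ?_ (Real.sqrt_le_sqrt (hg.2 hx hy ha hb hab))
  exact Real.strictConcaveOn_sqrt.concaveOn.2 (h0 x hx) (h0 y hy) ha hb hab

/-- A concave function dominates its chord in integral. -/
theorem chord_le_integral {g : ℝ → ℝ} {c : ℝ} (hg : ConcaveOn ℝ (Set.Icc c (c + 1)) g)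
    (hc : Continuous g) : (g c + g (c + 1)) / 2 ≤ ∫ x in c..(c + 1), g x := by
  have hle : ∫ x in c..(c + 1), (g c + (x - c) * (g (c + 1) - g c)) ≤ ∫ x in c..(c + 1), g x := by
    apply intervalIntegral.integral_mono_on (by linarith)
    · exact (by fun_prop : Continuous _).intervalIntegrable _ _
    · exact hc.intervalIntegrable _ _
    · intro x hx
      have hl : c ∈ Set.Icc c (c + 1) := ⟨le_rfl, by linarith⟩
      have hr : c + 1 ∈ Set.Icc c (c + 1) := ⟨by linarith, le_rfl⟩
      have := hg.2 hl hr (by linarith [hx.2] : 0 ≤ 1 - (x - c)) (by linarith [hx.1] : 0 ≤ x - c)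
        (by ring)
      simp only [smul_eq_mul] at this
      rw [show (1 - (x - c)) * c + (x - c) * (c + 1) = x by ring] at this
      linarith
  refine le_trans (le_of_eq ?_) hle
  rw [intervalIntegral.integral_add, intervalIntegral.integral_mul_const,
    intervalIntegral.integral_sub]
  · simp
    ring
  all_goals exact (by fun_prop : Continuous _).intervalIntegrable _ _

/-- The trapezoidal rule underestimates the integral of a concave function. -/
theorem sum_le_integral_of_concaveOn {g : ℝ → ℝ} {c : ℝ} (hc : Continuous g) (n : ℕ)
    (hg : ConcaveOn ℝ (Set.Icc c (c + n)) g) :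
    ∑ i ∈ Finset.range (n + 1), g (c + i) ≤
      (∫ x in c..(c + n), g x) + (g c + g (c + n)) / 2 := by
  induction n with
  | zero => simp
  | succ n ih =>
    rw [Finset.sum_range_succ]
    have h1 := ih (hg.subset (Set.Icc_subset_Icc_right (by push_cast; linarith)) (convex_Icc _ _))
    have h2 := chord_le_integral (c := c + n) (hg.subset
      (Set.Icc_subset_Icc (by linarith [n.cast_nonneg (α := ℝ)]) (by push_cast; linarith))
      (convex_Icc _ _)) hc
    have h3 := intervalIntegral.integral_add_adjacent_intervals (μ := MeasureTheory.volume)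
      (hc.intervalIntegrable c (c + n)) (hc.intervalIntegrable (c + n) (c + n + 1))
    push_cast
    rw [← add_assoc, ← h3]
    linarith

theorem integral_sqrt_one_sub_div_sq {Y : ℝ} (hY : 0 < Y) :
    ∫ y in (-Y)..Y, √(1 - (y / Y) ^ 2) = Y * (Real.pi / 2) := by
  have := intervalIntegral.integral_comp_div (a := -Y) (b := Y) (fun x => √(1 - x ^ 2)) hY.ne'
  rw [this, neg_div, div_self hY.ne', integral_sqrt_one_sub_sq, smul_eq_mul]

theorem concaveOn_sqrt_one_sub_div_sq {Y : ℝ} (hY : 0 < Y) :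
    ConcaveOn ℝ (Set.Icc (-Y) Y) fun y => √(1 - (y / Y) ^ 2) := by
  apply concaveOn_sqrt_comp
  · refine ⟨convex_Icc _ _, fun x _ y _ a b ha hb hab => ?_⟩
    obtain rfl : b = 1 - a := by linarith
    simp only [smul_eq_mul]
    have : 0 ≤ a * (1 - a) * (x / Y - y / Y) ^ 2 := by positivity
    rw [show (a * x + (1 - a) * y) / Y = a * (x / Y) + (1 - a) * (y / Y) by ring]
    nlinarith
  · intro x hx
    have : |x / Y| ≤ 1 := by
      rw [abs_div, abs_of_pos hY, div_le_one hY]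
      exact abs_le.2 hx
    have := (sq_le_one_iff_abs_le_one _).2 this
    linarith

/-! ### Length of an ellipse -/

theorem hasDerivAt_ellipsePoint (a b c θ : ℝ) :
    HasDerivAt (ellipsePoint a b c)
      (!₂[(-Real.sin θ - b / √(4 * a * c - b ^ 2) * Real.cos θ) / √a,
        2 * √a / √(4 * a * c - b ^ 2) * Real.cos θ]) θ := by
  refine ((PiLp.hasFDerivAt_toLp (𝕜 := ℝ) 2 _).comp_hasDerivAt θ (hasDerivAt_pi.2 fun i => ?_) :
    HasDerivAt (fun θ => WithLp.toLp 2 ![(Real.cos θ - b / √(4 * a * c - b ^ 2) * Real.sin θ) / √a,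
      2 * √a / √(4 * a * c - b ^ 2) * Real.sin θ]) _ θ)
  fin_cases i
  · simpa using ((Real.hasDerivAt_cos θ).sub
      ((Real.hasDerivAt_sin θ).const_mul (b / √(4 * a * c - b ^ 2)))).div_const √a
  · simpa using (Real.hasDerivAt_sin θ).const_mul (2 * √a / √(4 * a * c - b ^ 2))

/-- The speed of the standard parametrization of the ellipse. -/
theorem norm_deriv_ellipsePoint (a b c θ : ℝ) : ‖deriv (ellipsePoint a b c) θ‖ =
    √(((-Real.sin θ - b / √(4 * a * c - b ^ 2) * Real.cos θ) / √a) ^ 2 +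
      (2 * √a / √(4 * a * c - b ^ 2) * Real.cos θ) ^ 2) := by
  rw [(hasDerivAt_ellipsePoint a b c θ).deriv, EuclideanSpace.norm_eq]
  simp [Fin.sum_univ_two]

/-- An ellipse is at least as long as the broken line that bounds the rectangle spanned by a
horizontal chord and by the vertical distance to the opposite chord. -/
theorem le_ellipseLength (a b c : ℝ) {φ : ℝ} (h0 : 0 ≤ φ) (h1 : φ ≤ Real.pi / 2) :
    4 * Real.cos φ / √a + 8 * √a / √(4 * a * c - b ^ 2) * Real.sin φ ≤ ellipseLength a b c := by
  set d := √(4 * a * c - b ^ 2) with hd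
  set F : ℝ → ℝ := fun θ => √(((-Real.sin θ - b / d * Real.cos θ) / √a) ^ 2 +
      (2 * √a / d * Real.cos θ) ^ 2) with hF
  have hcont : Continuous F := by fun_prop
  have hint : ∀ x y : ℝ, IntervalIntegrable F MeasureTheory.volume x y :=
    fun x y => hcont.intervalIntegrable x y
  -- Central symmetry: the speed has period `π`, so the length is twice that of any half turn.
  have hper : Function.Periodic F Real.pi := by
    intro θ
    simp only [hF, Real.sin_add_pi, Real.cos_add_pi]
    congr 1
    ring
  have hL : ellipseLength a b c = 2 * ∫ θ in (-φ)..(-φ + Real.pi), F θ := by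
    have e : ellipseLength a b c = ∫ θ in (0 : ℝ)..(2 * Real.pi), F θ := by
      unfold ellipseLength
      simp only [norm_deriv_ellipsePoint, hF, hd]
    rw [e, ← intervalIntegral.integral_add_adjacent_intervals (hint 0 Real.pi) (hint Real.pi _)]
    have s1 := hper.intervalIntegral_add_eq 0 (-φ)
    have s2 := hper.intervalIntegral_add_eq Real.pi (-φ)
    rw [zero_add] at s1
    rw [← two_mul] at s2
    rw [s1, s2]
    ring
  -- On `[-φ, φ]` the speed is bounded below by its vertical component, on `[φ, π - φ]` by its
  -- horizontal one.
  have i1 : 4 * √a / d * Real.sin φ ≤ ∫ θ in (-φ)..φ, F θ := by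
    have : ∫ θ in (-φ)..φ, 2 * √a / d * Real.cos θ ≤ ∫ θ in (-φ)..φ, F θ := by
      apply intervalIntegral.integral_mono_on (by linarith) _ (hint _ _)
      · intro x _
        exact Real.le_sqrt_of_sq_le (le_add_of_nonneg_left (sq_nonneg _))
      · exact (by fun_prop : Continuous _).intervalIntegrable _ _
    refine le_trans (le_of_eq ?_) this
    rw [intervalIntegral.integral_const_mul, integral_cos, Real.sin_neg]
    ring
  have i2 : 2 * Real.cos φ / √a ≤ ∫ θ in φ..(-φ + Real.pi), F θ := by
    have : ∫ θ in φ..(-φ + Real.pi), (Real.sin θ + b / d * Real.cos θ) / √a ≤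
        ∫ θ in φ..(-φ + Real.pi), F θ := by
      apply intervalIntegral.integral_mono_on (by linarith) _ (hint _ _)
      · intro x _
        apply Real.le_sqrt_of_sq_le
        refine le_trans (le_of_eq ?_) (le_add_of_nonneg_right (sq_nonneg _))
        ring
      · exact (by fun_prop : Continuous _).intervalIntegrable _ _
    refine le_trans (le_of_eq ?_) this
    rw [intervalIntegral.integral_div, intervalIntegral.integral_add,
      intervalIntegral.integral_const_mul, integral_cos, integral_sin,
      show -φ + Real.pi = Real.pi - φ by ring, Real.sin_pi_sub, Real.cos_pi_sub]
    · ring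
    all_goals exact (by fun_prop : Continuous _).intervalIntegrable _ _
  have i3 := intervalIntegral.integral_add_adjacent_intervals (hint (-φ) φ)
    (hint φ (-φ + Real.pi))
  rw [hL, ← i3]
  calc _ = 2 * (4 * √a / d * Real.sin φ + 2 * Real.cos φ / √a) := by ring
    _ ≤ _ := by linarith

theorem ellipseLength_nonneg (a b c : ℝ) : 0 ≤ ellipseLength a b c :=
  intervalIntegral.integral_nonneg (by positivity) fun _ _ => norm_nonneg _

/-! ### Lattice points in an ellipse -/

theorem card_Icc_ceil_floor_le {r : ℝ} (hr : 0 ≤ r) (e : ℝ) :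
    ((Finset.Icc ⌈-e - r⌉ ⌊-e + r⌋).card : ℝ) ≤ 2 * r + 1 := by
  rw [Int.card_Icc]
  rcases le_total 0 (⌊-e + r⌋ + 1 - ⌈-e - r⌉) with h | h
  · have : ((⌊-e + r⌋ + 1 - ⌈-e - r⌉).toNat : ℝ) = ((⌊-e + r⌋ + 1 - ⌈-e - r⌉ : ℤ) : ℝ) := by
      exact_mod_cast Int.toNat_of_nonneg h
    rw [this]
    push_cast
    linarith [Int.floor_le (-e + r), Int.le_ceil (-e - r)]
  · rw [Int.toNat_of_nonpos h]
    simp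
    linarith

theorem sum_Icc_neg (J : ℕ) (f : ℝ → ℝ) :
    ∑ j ∈ Finset.Icc (-(J : ℤ)) J, f j = ∑ i ∈ Finset.range (2 * J + 1), f (-J + i) := by
  symm
  refine Finset.sum_bij (fun i _ => -(J : ℤ) + i) ?_ ?_ ?_ ?_
  · intro i hi
    simp at hi ⊢
    omega
  · intro i _ j _ h
    simpa using h
  · intro j hj
    simp at hj
    exact ⟨(j + J).toNat, by simp; omega, by simp; omega⟩
  · intro i _
    push_cast
    rfl

/-- The number of lattice points in an ellipse is at most its area plus half of its length
plus one. -/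
theorem exists_finset_lattice_points {a b c : ℝ} (ha : 0 < a) (hD : 0 < 4 * a * c - b ^ 2)
    {s : ℝ} (hs : 0 ≤ s) :
    ∃ T : Finset (ℤ × ℤ),
      (∀ x y : ℤ, a * x ^ 2 + b * x * y + c * y ^ 2 ≤ s → (x, y) ∈ T) ∧
      (T.card : ℝ) ≤ ellipseArea a b c * s + ellipseLength a b c / 2 * √s + 1 := by
  have key : ∀ x y : ℝ, 4 * a * (a * x ^ 2 + b * x * y + c * y ^ 2) =
      (2 * a * x + b * y) ^ 2 + (4 * a * c - b ^ 2) * y ^ 2 := fun x y => by ring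
  rcases hs.eq_or_lt with rfl | hs
  -- For `s = 0` definiteness leaves only the origin; this case is separate because the half-height
  -- `Y` used below would vanish.
  · refine ⟨{(0, 0)}, fun x y h => ?_, by simp⟩
    have h' := key x y
    have h1 : (4 * a * c - b ^ 2) * (y : ℝ) ^ 2 = 0 := by
      nlinarith [sq_nonneg (2 * a * (x : ℝ) + b * y), mul_nonneg hD.le (sq_nonneg (y : ℝ))]
    have hy : (y : ℝ) = 0 := by
      rcases mul_eq_zero.1 h1 with h | h
      · exact absurd h hD.ne'
      · exact pow_eq_zero_iff two_ne_zero |>.1 h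
    rw [hy] at h
    have hx : (x : ℝ) = 0 := by
      have : (x : ℝ) ^ 2 = 0 := by nlinarith [sq_nonneg (x : ℝ)]
      exact pow_eq_zero_iff two_ne_zero |>.1 this
    simp only [Finset.mem_singleton, Prod.mk.injEq]
    exact ⟨by exact_mod_cast hx, by exact_mod_cast hy⟩
  set d := √(4 * a * c - b ^ 2) with hd
  have hd0 : 0 < d := Real.sqrt_pos.2 hD
  have hd2 : d ^ 2 = 4 * a * c - b ^ 2 := Real.sq_sqrt hD.le
  have hra : 0 < √a := Real.sqrt_pos.2 ha
  have hra2 : √a ^ 2 = a := Real.sq_sqrt ha.le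
  have hrs : 0 < √s := Real.sqrt_pos.2 hs
  have hrs2 : √s ^ 2 = s := Real.sq_sqrt hs.le
  set Y := 2 * √a * √s / d with hYdef
  have hY : 0 < Y := by positivity
  set R := √s / √a with hRdef
  have hR : 0 < R := by positivity
  set J := ⌊Y⌋₊ with hJ
  have hJY : (J : ℝ) ≤ Y := Nat.floor_le hY.le
  set g : ℝ → ℝ := fun y => √(1 - (y / Y) ^ 2) with hg
  have hg0 : ∀ y, 0 ≤ g y := fun y => Real.sqrt_nonneg _
  have hgc : Continuous g := by fun_prop
  -- Row `y = j` of the ellipse is centred at `-b j / (2 a)` with half-width `R g(j)`; the embedding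
  -- swaps `(y, x)` to `(x, y)`.
  refine ⟨((Finset.Icc (-(J : ℤ)) J).sigma fun j =>
    Finset.Icc ⌈-(b * j / (2 * a)) - R * g j⌉ ⌊-(b * j / (2 * a)) + R * g j⌋).map
      ⟨fun p => (p.2, p.1), ?_⟩, ?_, ?_⟩
  · rintro ⟨p, q⟩ ⟨p', q'⟩ h
    simp at h
    simp [h]
  · intro x y h
    have hk := key x y
    have hle : (2 * a * x + b * y) ^ 2 + d ^ 2 * (y : ℝ) ^ 2 ≤ 4 * a * s := by
      rw [hd2, ← hk]
      exact mul_le_mul_of_nonneg_left h (by positivity)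
    have hYs : Y ^ 2 * d ^ 2 = 4 * a * s := by
      rw [hYdef, div_pow, mul_pow, mul_pow, hra2, hrs2]
      field_simp
      ring
    have hyY : |(y : ℝ)| ≤ Y := by
      apply abs_le_of_sq_le_sq _ hY.le
      have : d ^ 2 * (y : ℝ) ^ 2 ≤ d ^ 2 * Y ^ 2 := by
        linarith [sq_nonneg (2 * a * (x : ℝ) + b * y)]
      exact le_of_mul_le_mul_left this (by positivity)
    have hyJ : y.natAbs ≤ J := by
      apply Nat.le_floor
      rwa [Nat.cast_natAbs, Int.cast_abs]
    have hx : |(x : ℝ) + b * y / (2 * a)| ≤ R * g y := by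
      apply abs_le_of_sq_le_sq _ (mul_nonneg hR.le (hg0 _))
      have h1 : 0 ≤ 1 - ((y : ℝ) / Y) ^ 2 := by
        have : |(y : ℝ) / Y| ≤ 1 := by rwa [abs_div, abs_of_pos hY, div_le_one hY]
        linarith [(sq_le_one_iff_abs_le_one _).2 this]
      rw [mul_pow, hg, Real.sq_sqrt h1, hRdef, div_pow, hra2, hrs2]
      have e1 : ((y : ℝ) / Y) ^ 2 = d ^ 2 * y ^ 2 / (4 * a * s) := by
        rw [← hYs]
        field_simp
      rw [e1]
      have e2 : ((x : ℝ) + b * y / (2 * a)) ^ 2 = (2 * a * x + b * y) ^ 2 / (4 * a ^ 2) := by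
        field_simp
        ring
      have e3 : s / a * (1 - d ^ 2 * (y : ℝ) ^ 2 / (4 * a * s)) =
          (4 * a * s - d ^ 2 * y ^ 2) / (4 * a ^ 2) := by
        field_simp
      rw [e2, e3]
      gcongr
      linarith
    simp only [Finset.mem_map, Finset.mem_sigma, Finset.mem_Icc]
    refine ⟨⟨y, x⟩, ⟨⟨by dsimp only; omega, by dsimp only; omega⟩, ?_, ?_⟩, rfl⟩
    · rw [Int.ceil_le]
      linarith [(abs_le.1 hx).1]
    · rw [Int.le_floor]
      linarith [(abs_le.1 hx).2]
  · rw [Finset.card_map, Finset.card_sigma]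
    push_cast
    have h1 : ∑ j ∈ Finset.Icc (-(J : ℤ)) J,
        ((Finset.Icc ⌈-(b * j / (2 * a)) - R * g j⌉ ⌊-(b * j / (2 * a)) + R * g j⌋).card : ℝ) ≤
        ∑ j ∈ Finset.Icc (-(J : ℤ)) J, (2 * (R * g j) + 1) :=
      Finset.sum_le_sum fun j _ => card_Icc_ceil_floor_le (mul_nonneg hR.le (hg0 _)) _
    have h2 : ∑ j ∈ Finset.Icc (-(J : ℤ)) J, (2 * (R * g j) + 1) =
        2 * R * (∑ i ∈ Finset.range (2 * J + 1), g (-J + i)) + (2 * J + 1) := by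
      rw [← sum_Icc_neg J g, Finset.sum_add_distrib, Finset.mul_sum]
      congr 1
      · exact Finset.sum_congr rfl fun _ _ => by ring
      · simp
        have : ((J : ℤ) + 1 + J).toNat = 2 * J + 1 := by omega
        rw [this]
        push_cast
        ring
    -- By symmetry the trapezoidal correction is `g J`, the half-width of the extreme row up to the
    -- factor `R`.
    have h3 := sum_le_integral_of_concaveOn (c := -(J : ℝ)) hgc (2 * J) (by
      refine (concaveOn_sqrt_one_sub_div_sq hY).subset (Set.Icc_subset_Icc (by linarith) ?_)
        (convex_Icc _ _)
      push_cast
      linarith)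
    rw [show -(J : ℝ) + ((2 * J : ℕ) : ℝ) = J by push_cast; ring] at h3
    have hgneg : g (-J) = g J := by simp [hg, neg_div]
    have h4 : ∫ x in (-(J : ℝ))..J, g x ≤ Y * (Real.pi / 2) := by
      rw [← integral_sqrt_one_sub_div_sq hY]
      exact intervalIntegral.integral_mono_interval (by linarith)
        (by linarith [J.cast_nonneg (α := ℝ)]) hJY (Eventually.of_forall hg0)
        (hgc.intervalIntegrable _ _)
    have hJ1 : (J : ℝ) / Y ≤ 1 := (div_le_one hY).2 hJY
    have hJ0 : 0 ≤ (J : ℝ) / Y := by positivity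
    -- The ellipse reaches relative height `J / Y` at this angle. After scaling by `√s`, half its
    -- length is at least the extreme row plus the vertical distance `2 J`, which absorbs both
    -- boundary terms.
    have h5 := le_ellipseLength a b c (Real.arcsin_nonneg.2 hJ0) (Real.arcsin_le_pi_div_two _)
    rw [Real.sin_arcsin (by linarith) hJ1, Real.cos_arcsin] at h5
    change 4 * g J / √a + 8 * √a / d * (J / Y) ≤ _ at h5
    have h6 : 2 * R * g J + 2 * J ≤ ellipseLength a b c / 2 * √s := by
      refine le_trans (le_of_eq ?_) (mul_le_mul_of_nonneg_right
        (div_le_div_of_nonneg_right h5 (by norm_num : (0 : ℝ) ≤ 2)) hrs.le)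
      rw [hRdef, hYdef]
      field_simp
      ring
    have h7 : ellipseArea a b c * s = 2 * R * (Y * (Real.pi / 2)) := by
      have : √(a * c - b ^ 2 / 4) = d / 2 := by
        rw [show a * c - b ^ 2 / 4 = (d / 2) ^ 2 by rw [div_pow, hd2]; ring]
        exact Real.sqrt_sq (by positivity)
      rw [ellipseArea, this, hRdef, hYdef]
      field_simp
      rw [hrs2]
    have h8 : 2 * R * (∑ i ∈ Finset.range (2 * J + 1), g (-J + i)) ≤
        2 * R * (Y * (Real.pi / 2) + g J) := by
      apply mul_le_mul_of_nonneg_left _ (by positivity)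
      rw [hgneg] at h3
      linarith
    linarith

/-! ### Sums of `d (k - d)` and of its square root -/

theorem concaveOn_sqrt_mul_sub {k : ℝ} : ConcaveOn ℝ (Set.Icc 0 k) fun x => √(x * (k - x)) := by
  apply concaveOn_sqrt_comp
  · refine ⟨convex_Icc _ _, fun x _ y _ a b ha hb hab => ?_⟩
    obtain rfl : b = 1 - a := by linarith
    simp only [smul_eq_mul]
    have : 0 ≤ a * (1 - a) * (x - y) ^ 2 := by positivity
    nlinarith
  · exact fun x hx => mul_nonneg hx.1 (sub_nonneg.2 hx.2)

/-- The graph is the upper half of the circle with diameter `[0, k]`. -/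
theorem integral_sqrt_mul_sub {k : ℝ} (hk : 0 < k) :
    ∫ x in (0 : ℝ)..k, √(x * (k - x)) = Real.pi / 8 * k ^ 2 := by
  have h : ∀ x, √(x * (k - x)) = (k / 2) * √(1 - ((x - k / 2) / (k / 2)) ^ 2) := fun x => by
    rw [show x * (k - x) = (k / 2) ^ 2 * (1 - ((x - k / 2) / (k / 2)) ^ 2) by field_simp; ring,
      Real.sqrt_mul (sq_nonneg _), Real.sqrt_sq (by positivity)]
  simp only [h]
  rw [intervalIntegral.integral_const_mul,
    intervalIntegral.integral_comp_sub_right (fun x => √(1 - (x / (k / 2)) ^ 2)) (k / 2),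
    show 0 - k / 2 = -(k / 2) by ring, show k - k / 2 = k / 2 by ring,
    integral_sqrt_one_sub_div_sq (by positivity)]
  ring

theorem le_integral_sqrt_mul_sub {k : ℝ} (hk : 1 ≤ k) :
    7 / 12 * √(k - 1) ≤ ∫ x in (0 : ℝ)..1, √(x * (k - x)) := by
  -- On `[0, 1]`, `k - x ≥ k - 1`, and `√x` lies above this quadratic, which is tangent to it at
  -- `1`; the quadratic has integral `7 / 12`.
  have : ∫ x in (0 : ℝ)..1, √(k - 1) * (3 / 2 * x - 1 / 2 * x ^ 2) ≤
      ∫ x in (0 : ℝ)..1, √(x * (k - x)) := by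
    apply intervalIntegral.integral_mono_on zero_le_one
    · exact (by fun_prop : Continuous _).intervalIntegrable _ _
    · exact (by fun_prop : Continuous _).intervalIntegrable _ _
    · rintro x ⟨h0, h1⟩
      apply Real.le_sqrt_of_sq_le
      rw [mul_pow, Real.sq_sqrt (by linarith)]
      have h2 : (3 / 2 * x - 1 / 2 * x ^ 2) ^ 2 ≤ x := by
        have : 0 ≤ x * ((1 - x) ^ 2 * (4 - x)) :=
          mul_nonneg h0 (mul_nonneg (sq_nonneg _) (by linarith))
        linarith
      nlinarith
  refine le_trans (le_of_eq ?_) this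
  rw [intervalIntegral.integral_const_mul, intervalIntegral.integral_sub,
    intervalIntegral.integral_const_mul, intervalIntegral.integral_const_mul, integral_id,
    integral_pow]
  · norm_num
    ring
  all_goals exact (by fun_prop : Continuous _).intervalIntegrable _ _

/-- The trapezoidal rule on `[1, k - 1]` adds `√(k - 1)` to the integral, while the two omitted end
pieces of the half disc have area at least `7 / 6 √(k - 1)`. The gain is at least `√(k - 1) / 6 ≥ 1
/ 6`, more than is needed. -/
theorem sum_sqrt_mul_sub_le (k : ℕ) (hk : 2 ≤ k) :
    ∑ d ∈ Finset.Ico 1 k, √((d : ℝ) * (k - d)) ≤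
      Real.pi / 8 * (k : ℝ) ^ 2 - ((k : ℝ) - 2) / (6 * k) := by
  obtain ⟨n, rfl⟩ := Nat.exists_eq_add_of_le hk
  set K : ℝ := ((2 + n : ℕ) : ℝ) with hK
  have hKn : K = 2 + n := by simp [hK]
  have hn : (0 : ℝ) ≤ n := n.cast_nonneg
  set p : ℝ → ℝ := fun x => √(x * (K - x)) with hp
  have hpc : Continuous p := by fun_prop
  have hsym : ∀ x, p (K - x) = p x := fun x => by simp only [hp]; congr 1; ring
  have h1 := sum_le_integral_of_concaveOn (g := p) (c := 1) hpc n
    (concaveOn_sqrt_mul_sub.subset (Set.Icc_subset_Icc (by linarith) (by linarith))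
      (convex_Icc _ _))
  rw [show (1 : ℝ) + n = K - 1 by rw [hKn]; ring, hsym] at h1
  have h2 := le_integral_sqrt_mul_sub (k := K) (by linarith)
  have h3 : ∫ x in (K - 1)..K, p x = ∫ x in (0 : ℝ)..1, p x := by
    have := intervalIntegral.integral_comp_sub_left p K (a := 0) (b := 1)
    simp only [hsym, sub_zero] at this
    exact this.symm
  have h4 := integral_sqrt_mul_sub (k := K) (by linarith)
  have h5 := intervalIntegral.integral_add_adjacent_intervals (μ := MeasureTheory.volume)
    (hpc.intervalIntegrable 0 1) (hpc.intervalIntegrable 1 (K - 1))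
  have h6 := intervalIntegral.integral_add_adjacent_intervals (μ := MeasureTheory.volume)
    (hpc.intervalIntegrable 0 (K - 1)) (hpc.intervalIntegrable (K - 1) K)
  have h7 : ∑ d ∈ Finset.Ico 1 (2 + n), √((d : ℝ) * (K - d)) =
      ∑ i ∈ Finset.range (n + 1), p (1 + i) := by
    rw [Finset.sum_Ico_eq_sum_range, show 2 + n - 1 = n + 1 by omega]
    simp [hp]
  have h8 : 1 ≤ √(K - 1) := Real.one_le_sqrt.2 (by linarith)
  have h9 : (K - 2) / (6 * K) ≤ 1 / 6 := by
    rw [div_le_div_iff₀ (by linarith) (by norm_num)]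
    linarith
  have h10 : p 1 = √(K - 1) := by simp [hp]
  rw [h7]
  change 7 / 12 * √(K - 1) ≤ ∫ x in (0 : ℝ)..1, p x at h2
  change ∫ x in (0 : ℝ)..K, p x = _ at h4
  linarith

theorem sum_mul_sub (k : ℕ) :
    ∑ d ∈ Finset.Ico 1 k, (d : ℝ) * (k - d) = (k : ℝ) ^ 3 / 6 - k / 6 := by
  have h : ∀ (j : ℕ) (c : ℝ), ∑ d ∈ Finset.range j, (d : ℝ) * (c - d) =
      c * (j * (j - 1) / 2) - (j - 1) * j * (2 * j - 1) / 6 := by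
    intro j c
    induction j with
    | zero => simp
    | succ j ih =>
      rw [Finset.sum_range_succ, ih]
      push_cast
      ring
  rcases k.eq_zero_or_pos with rfl | hk
  · simp
  have := h k k
  rw [Finset.range_eq_Ico, Finset.sum_eq_sum_Ico_succ_bot hk] at this
  simp only [Nat.cast_zero, zero_mul, zero_add] at this
  rw [this]
  ring

/-! ### Invariants of an elliptic curve in `E²` -/

theorem mem_lattice_iff {τ : ℍ} {x : ℂ} :
    x ∈ lattice τ ↔ ∃ p q : ℤ, x = p + q * (τ : ℂ) := by
  rw [lattice, AddSubgroup.mem_closure_pair]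
  simp only [zsmul_eq_mul, mul_one, eq_comm]

theorem lattice_coord_eq_zero {τ : ℍ} {p q : ℤ} (h : (p : ℂ) + q * (τ : ℂ) = 0) :
    p = 0 ∧ q = 0 := by
  have h1 := congrArg Complex.im h
  simp [τ.im_ne_zero] at h1
  subst h1
  exact ⟨by simpa using h, rfl⟩

/-- The polarization form of `E` takes integral values on the period lattice. -/
theorem form_mem_int {τ : ℍ} {x y : ℂ} (hx : x ∈ lattice τ) (hy : y ∈ lattice τ) :
    ∃ k : ℤ, (x * starRingEnd ℂ y).im / τ.im = k := by
  obtain ⟨p, q, rfl⟩ := mem_lattice_iff.1 hx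
  obtain ⟨p', q', rfl⟩ := mem_lattice_iff.1 hy
  refine ⟨q * p' - p * q', ?_⟩
  rw [div_eq_iff τ.im_ne_zero]
  simp
  ring

/-- The subgroup of `E²` that is the image of the complex line spanned by `v`. -/
def lineImage (τ : ℍ) (v : ℂ × ℂ) : AddSubgroup (Curve τ × Curve τ) :=
  (Submodule.span ℂ {v}).toAddSubgroup.map (proj τ)

theorem lineImage_eq {τ : ℍ} {v v' : ℂ × ℂ} {c : ℂ} (hc : c ≠ 0) (h : v' = c • v) :
    lineImage τ v' = lineImage τ v := by
  rw [lineImage, lineImage, h, Submodule.span_singleton_smul_eq hc.isUnit]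

/-- A period basis of an elliptic curve in `E²` has the form `x, c x` with `Im c > 0`, up to
the sign of the second vector. -/
theorem IsEllipticCurve.exists_periods {τ : ℍ} {F : AddSubgroup (Curve τ × Curve τ)}
    (hF : IsEllipticCurve τ F) : ∃ (x : ℂ × ℂ) (c : ℂ), x ∈ lattice2 τ ∧ c • x ∈ lattice2 τ ∧
      x ≠ 0 ∧ 0 < c.im ∧ F = lineImage τ x ∧
      ∀ m n : ℕ, degree τ m n F =
        m * (c.im / τ.im * Complex.normSq x.1) + n * (c.im / τ.im * Complex.normSq x.2) := by
  obtain ⟨L, hL, hB, hFL⟩ := hF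
  have hper : L.toAddSubgroup ⊓ lattice2 τ = periods τ F := by
    rw [periods, hFL, tangentSpace_map]
  rw [hper] at hB
  obtain ⟨B⟩ := hB
  have hmem : ∀ i, ((B i : ↥(periods τ F)) : ℂ × ℂ) ∈ L ∧
      ((B i : ↥(periods τ F)) : ℂ × ℂ) ∈ lattice2 τ := by
    intro i
    have h : ((B i : ↥(periods τ F)) : ℂ × ℂ) ∈ periods τ F := (B i).2
    exact hper.ge h
  have hind : ∀ p q : ℤ, p • ((B 0 : ↥(periods τ F)) : ℂ × ℂ) +
      q • ((B 1 : ↥(periods τ F)) : ℂ × ℂ) = 0 → p = 0 ∧ q = 0 := by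
    intro p q h
    have := Fintype.linearIndependent_iff.1 B.linearIndependent ![p, q]
      (Subtype.ext (by simpa [Fin.sum_univ_two] using h))
    exact ⟨this 0, this 1⟩
  have hdeg := fun m n => degree_eq τ m n F B
  generalize hx : ((B 0 : ↥(periods τ F)) : ℂ × ℂ) = x at *
  generalize hy : ((B 1 : ↥(periods τ F)) : ℂ × ℂ) = y at *
  have hxm := hx ▸ hmem 0
  have hym := hy ▸ hmem 1
  have hx0 : x ≠ 0 := by
    rintro rfl
    exact one_ne_zero (hind 1 0 (by simp)).1
  have hspan : Submodule.span ℂ {x} = L := by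
    have : FiniteDimensional ℂ L := Module.finite_of_finrank_pos (by omega)
    apply Submodule.eq_of_le_of_finrank_eq
    · simpa using hxm.1
    · rw [finrank_span_singleton hx0, hL]
  obtain ⟨c, rfl⟩ := Submodule.mem_span_singleton.1 (hspan.ge hym.1)
  -- A real multiplier of a nonzero period into `Λ` is rational, which would contradict the
  -- independence of `x` and `c • x` over `ℤ`.
  have hreal : ∀ z ∈ lattice τ, c * z ∈ lattice τ → z ≠ 0 → c.im = 0 →
      ∃ p q : ℤ, q ≠ 0 ∧ q * c = p := by
    intro z hz hcz hz0 hc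
    obtain ⟨p, q, rfl⟩ := mem_lattice_iff.1 hz
    obtain ⟨p', q', h⟩ := mem_lattice_iff.1 hcz
    obtain ⟨r, rfl⟩ : ∃ r : ℝ, c = r := ⟨c.re, Complex.ext (by simp) (by simp [hc])⟩
    have h1 := congrArg Complex.im h
    have h2 := congrArg Complex.re h
    simp at h1 h2
    have h3 : r * q = q' := by
      apply mul_right_cancel₀ τ.im_ne_zero
      linarith
    by_cases hq : q = 0
    · subst hq
      refine ⟨p', p, ?_, ?_⟩
      · rintro rfl
        simp at hz0
      · have : (p : ℝ) * r = p' := by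
          have : (q' : ℝ) = 0 := by rw [← h3]; simp
          rw [this] at h2
          simp at h2
          linarith
        exact_mod_cast this
    · refine ⟨q', q, hq, ?_⟩
      have : (q : ℝ) * r = q' := by linarith
      exact_mod_cast this
  have hcim : c.im ≠ 0 := by
    intro hc
    have : ∃ p q : ℤ, q ≠ 0 ∧ q * c = p := by
      by_cases h1 : x.1 = 0
      · exact hreal x.2 hxm.2.2 hym.2.2 (fun h2 => hx0 (Prod.ext h1 h2)) hc
      · exact hreal x.1 hxm.2.1 hym.2.1 h1 hc
    obtain ⟨p, q, hq, h⟩ := this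
    refine hq (hind (-p) q ?_).2
    rw [← Int.cast_smul_eq_zsmul ℂ, ← Int.cast_smul_eq_zsmul ℂ, smul_smul, h, ← add_smul]
    simp
  have hpol : ∀ m n : ℕ, degree τ m n F =
      m * (|c.im| / τ.im * Complex.normSq x.1) + n * (|c.im| / τ.im * Complex.normSq x.2) := by
    intro m n
    have h1 : polarization τ m n x (c • x) = -c.im *
        ((m * Complex.normSq x.1 + n * Complex.normSq x.2) / τ.im) := by
      simp [polarization, Complex.normSq_apply]
      ring
    rw [hdeg, h1, abs_mul, abs_neg, abs_of_nonneg (a := _ / _)]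
    · ring
    · have := τ.im_pos
      have := Complex.normSq_nonneg x.1
      have := Complex.normSq_nonneg x.2
      positivity
  have hFx : F = lineImage τ x := by rw [hFL, lineImage, hspan]
  rcases hcim.lt_or_gt with h | h
  · refine ⟨x, -c, hxm.2, ?_, hx0, by simpa using h, hFx, ?_⟩
    · rw [neg_smul]
      exact neg_mem hym.2
    · simpa only [abs_of_neg h, Complex.neg_im] using hpol
  · refine ⟨x, c, hxm.2, hym.2, hx0, h, hFx, ?_⟩
    simpa only [abs_of_pos h] using hpol

/-- An elliptic curve in `E²` is determined by the endomorphism `z` of `E` and the degrees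
`d₁`, `d₂` of its projections to the two factors, where `d₁ d₂ = |z|²`. -/
theorem IsEllipticCurve.exists_degrees {τ : ℍ} {F : AddSubgroup (Curve τ × Curve τ)}
    (hF : IsEllipticCurve τ F) : ∃ (d₁ d₂ : ℕ) (z : ℂ),
      (∀ u ∈ lattice τ, z * u ∈ lattice τ) ∧ Complex.normSq z = d₁ * d₂ ∧ 0 < d₁ + d₂ ∧
      (∀ m n : ℕ, degree τ m n F = m * d₁ + n * d₂) ∧
      (d₁ = 0 → F = lineImage τ (0, 1)) ∧
      (d₂ = 0 → F = lineImage τ (1, 0)) ∧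
      (d₁ ≠ 0 → F = lineImage τ (d₁, starRingEnd ℂ z)) := by
  obtain ⟨x, c, hx, hcx, hx0, hc, hFx, hdeg⟩ := hF.exists_periods
  have hκ : 0 < c.im / τ.im := div_pos hc τ.im_pos
  set κ := c.im / τ.im with hκd
  have hnat : ∀ y : ℂ, y ∈ lattice τ → c * y ∈ lattice τ →
      ∃ d : ℕ, κ * Complex.normSq y = d := by
    intro y hy hcy
    obtain ⟨k, hk⟩ := form_mem_int hcy hy
    have e : (c * y * starRingEnd ℂ y).im / τ.im = κ * Complex.normSq y := by
      simp [hκd, Complex.normSq_apply]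
      ring
    rw [e] at hk
    have hk0 : 0 ≤ k := by
      have : (0 : ℝ) ≤ k := hk ▸ mul_nonneg hκ.le (Complex.normSq_nonneg _)
      exact_mod_cast this
    lift k to ℕ using hk0
    exact ⟨k, by simpa using hk⟩
  obtain ⟨d₁, hd₁⟩ := hnat x.1 hx.1 hcx.1
  obtain ⟨d₂, hd₂⟩ := hnat x.2 hx.2 hcx.2
  have zero_iff : ∀ (y : ℂ) (d : ℕ), κ * Complex.normSq y = d → (d = 0 ↔ y = 0) := by
    intro y d h
    rw [← Nat.cast_eq_zero (R := ℝ), ← h]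
    simp [hκ.ne']
  have h1 := zero_iff _ _ hd₁
  have h2 := zero_iff _ _ hd₂
  -- In the coordinate where `F` has periods `ℤ + ℤc`, the projections are multiplication by `xᵢ`,
  -- and the dual of the second is multiplication by `κ x̄₂`.
  refine ⟨d₁, d₂, κ * x.1 * starRingEnd ℂ x.2, ?_, ?_, ?_, ?_, ?_, ?_, ?_⟩
  · intro u hu
    obtain ⟨k, hk⟩ := form_mem_int hcx.2 hu
    obtain ⟨l, hl⟩ := form_mem_int hu hx.2
    have e : (κ : ℂ) * x.1 * starRingEnd ℂ x.2 * u = k • x.1 + l • (c * x.1) := by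
      -- This places the image of `u` under the dual projection in `ℤ + ℤc`; its coordinates are
      -- values of the integral form of `E`.
      have e1 : (κ : ℂ) * (starRingEnd ℂ x.2 * u) = (k : ℝ) + (l : ℝ) * c := by
        rw [← hk, ← hl, hκd]
        apply Complex.ext
        · simp
          ring
        · simp
          ring
      rw [zsmul_eq_mul, zsmul_eq_mul]
      push_cast at e1
      linear_combination x.1 * e1
    rw [e]
    exact (lattice τ).add_mem ((lattice τ).zsmul_mem hx.1 _) ((lattice τ).zsmul_mem hcx.1 _)
  · rw [← hd₁, ← hd₂]
    simp
    ring
  · by_contra h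
    exact hx0 (Prod.ext (h1.1 (by omega)) (h2.1 (by omega)))
  · intro m n
    rw [hdeg, hd₁, hd₂]
  · intro h
    have h0 := h1.1 h
    rw [hFx]
    have hx2 : x.2 ≠ 0 := fun h' => hx0 (Prod.ext h0 h')
    exact lineImage_eq hx2 (Prod.ext (by simp [h0]) (by simp))
  · intro h
    have h0 := h2.1 h
    rw [hFx]
    have hx1 : x.1 ≠ 0 := fun h' => hx0 (Prod.ext h' h0)
    exact lineImage_eq hx1 (Prod.ext (by simp) (by simp [h0]))
  · intro h
    have hx1 : x.1 ≠ 0 := fun h' => h (h1.2 h')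
    rw [hFx]
    symm
    have hne : (κ : ℂ) * starRingEnd ℂ x.1 ≠ 0 := by
      simp [hκ.ne', hx1]
    refine lineImage_eq hne (Prod.ext ?_ ?_)
    · have : (d₁ : ℂ) = ((κ * Complex.normSq x.1 : ℝ) : ℂ) := by rw [hd₁]; simp
      simp only [this, Prod.smul_fst, smul_eq_mul]
      rw [Complex.ofReal_mul, Complex.normSq_eq_conj_mul_self]
      ring
    · simp

/-- Without complex multiplication, every elliptic curve in `E²` is the image of a line with
integral coordinates `(a, b)`, and its degree is at least `m a² + n b²`. -/
theorem IsEllipticCurve.exists_int {τ : ℍ} (hτ : ¬ HasCM τ) {F : AddSubgroup (Curve τ × Curve τ)}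
    (hF : IsEllipticCurve τ F) : ∃ a b : ℤ, F = lineImage τ (a, b) ∧
      ∀ m n : ℕ, (m : ℝ) * a ^ 2 + n * b ^ 2 ≤ degree τ m n F := by
  obtain ⟨d₁, d₂, z, hz, hn, hpos, hdeg, h1, -, h3⟩ := hF.exists_degrees
  obtain ⟨l, rfl⟩ : ∃ l : ℤ, z = l := by
    by_contra! h
    exact hτ ⟨z, hz, h⟩
  rcases Nat.eq_zero_or_pos d₁ with rfl | hd
  · refine ⟨0, 1, by simpa using h1 rfl, fun m n => ?_⟩
    rw [hdeg]
    have : (1 : ℝ) ≤ d₂ := by exact_mod_cast (by omega : 1 ≤ d₂)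
    simp
    exact le_mul_of_one_le_right (by positivity) this
  · have hF' := h3 hd.ne'
    have hn' : l ^ 2 = d₁ * d₂ := by
      have : (l : ℝ) * l = d₁ * d₂ := by simpa using hn
      rw [sq]
      exact_mod_cast this
    have hd' : (d₁ : ℤ) ≠ 0 := by exact_mod_cast hd.ne'
    -- Write `(d₁, l) = g (a, b)` with `a`, `b` coprime. Then `g b² = a d₂` forces `a ∣ g`, so `d₁ =
    -- e a²` and `d₂ = e b²` with `e ≥ 1`.
    obtain ⟨g, a, b, hg, hab, ha, hb⟩ := Int.exists_gcd_one' (m := d₁) (n := l)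
      (Int.gcd_pos_of_ne_zero_left _ hd')
    have ha0 : a ≠ 0 := by
      rintro rfl
      simp at ha
      omega
    have hg0 : (g : ℤ) ≠ 0 := by exact_mod_cast hg.ne'
    have hgd : (g : ℤ) * b ^ 2 = a * d₂ := by
      apply mul_right_cancel₀ hg0
      rw [hb, ha] at hn'
      linear_combination hn'
    have hdvd : a ∣ g := by
      have h4 : IsCoprime a (b ^ 2) := (Int.isCoprime_iff_gcd_eq_one.2 hab).pow_right
      exact h4.dvd_of_dvd_mul_right ⟨d₂, hgd⟩
    obtain ⟨e, he⟩ := hdvd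
    have hd1 : (d₁ : ℤ) = e * a ^ 2 := by rw [ha, he]; ring
    have hd2 : (d₂ : ℤ) = e * b ^ 2 := by
      apply mul_left_cancel₀ ha0
      rw [← hgd, he]
      ring
    have he1 : 1 ≤ e := by
      by_contra h
      have : e * a ^ 2 ≤ 0 := mul_nonpos_of_nonpos_of_nonneg (by omega) (sq_nonneg _)
      omega
    refine ⟨a, b, ?_, fun m n => ?_⟩
    · rw [hF']
      apply lineImage_eq (c := g) (by exact_mod_cast hg0)
      have e1 : (d₁ : ℂ) = a * g := by exact_mod_cast ha
      have e2 : (l : ℂ) = b * g := by exact_mod_cast hb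
      refine Prod.ext ?_ ?_
      · simp [e1, mul_comm]
      · simp [e2, mul_comm]
    · rw [hdeg]
      have e1 : (d₁ : ℝ) = e * a ^ 2 := by exact_mod_cast hd1
      have e2 : (d₂ : ℝ) = e * b ^ 2 := by exact_mod_cast hd2
      have e3 : (1 : ℝ) ≤ e := by exact_mod_cast he1
      rw [e1, e2]
      have e4 : 0 ≤ (m : ℝ) * (a : ℝ) ^ 2 + n * (b : ℝ) ^ 2 := by positivity
      linarith [le_mul_of_one_le_left e4 e3]

/-! ### The endomorphism ring under complex multiplication -/

/-- With complex multiplication, `τ` satisfies a primitive integral quadratic equation. -/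
theorem HasCM.exists_equation {τ : ℍ} (h : HasCM τ) : ∃ u v w : ℤ, 0 < w ∧
    Int.gcd (Int.gcd u v) w = 1 ∧ (w : ℂ) * (τ : ℂ) ^ 2 + u * (τ : ℂ) + v = 0 := by
  obtain ⟨z, hz, hz'⟩ := h
  obtain ⟨a, b, hab⟩ := mem_lattice_iff.1 (hz 1 (mem_lattice_iff.2 ⟨1, 0, by simp⟩))
  obtain ⟨p, r, hpr⟩ := mem_lattice_iff.1 (hz τ (mem_lattice_iff.2 ⟨0, 1, by simp⟩))
  rw [mul_one] at hab
  have hb : b ≠ 0 := by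
    rintro rfl
    exact hz' a (by simpa using hab)
  obtain ⟨u, v, w, hw, he⟩ : ∃ u v w : ℤ, 0 < w ∧
      (w : ℂ) * (τ : ℂ) ^ 2 + u * (τ : ℂ) + v = 0 := by
    rw [hab] at hpr
    rcases hb.lt_or_gt with hb | hb
    · refine ⟨r - a, p, -b, by omega, ?_⟩
      push_cast
      linear_combination -hpr
    · refine ⟨a - r, -p, b, hb, ?_⟩
      push_cast
      linear_combination hpr
  have hg : 0 < Int.gcd (Int.gcd u v) w := Int.gcd_pos_of_ne_zero_right _ hw.ne'
  set g := Int.gcd (Int.gcd u v) w with hgd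
  have hguv : (g : ℤ) ∣ Int.gcd u v := Int.gcd_dvd_left ..
  obtain ⟨w', hw'⟩ : (g : ℤ) ∣ w := Int.gcd_dvd_right ..
  obtain ⟨u', hu'⟩ := hguv.trans (Int.gcd_dvd_left ..)
  obtain ⟨v', hv'⟩ := hguv.trans (Int.gcd_dvd_right ..)
  have hg0 : (0 : ℤ) < g := by exact_mod_cast hg
  refine ⟨u', v', w', ?_, ?_, ?_⟩
  · rw [hw'] at hw
    exact pos_of_mul_pos_right hw hg0.le
  · have : g = g * Int.gcd (Int.gcd u' v') w' := by
      conv_lhs => rw [hgd, hu', hv', hw', Int.gcd_mul_left, Int.natAbs_natCast, Nat.cast_mul,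
        Int.gcd_mul_left, Int.natAbs_natCast]
    exact (Nat.eq_of_mul_eq_mul_left hg (by rw [← this, mul_one]))
  · have hgc : (g : ℂ) ≠ 0 := by exact_mod_cast hg.ne'
    apply mul_left_cancel₀ hgc
    rw [hu', hv', hw'] at he
    push_cast at he
    linear_combination he

section Equation

variable {τ : ℍ} {u v w : ℤ}

/-- The roots of the quadratic are `τ` and its conjugate; these are the formulas for their sum and
product. -/
theorem re_im_of_equation (h : (w : ℂ) * (τ : ℂ) ^ 2 + u * (τ : ℂ) + v = 0) :
    2 * w * τ.re + u = 0 ∧ w * (τ.re ^ 2 + τ.im ^ 2) = (v : ℝ) := by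
  have h1 := congrArg Complex.im h
  have h2 := congrArg Complex.re h
  simp [sq] at h1 h2
  have h3 : 2 * w * τ.re + u = 0 := by
    apply mul_right_cancel₀ τ.im_ne_zero
    linarith
  refine ⟨h3, ?_⟩
  linear_combination τ.re * h3 - h2

theorem discr_neg_of_equation (hw : 0 < w)
    (h : (w : ℂ) * (τ : ℂ) ^ 2 + u * (τ : ℂ) + v = 0) : u ^ 2 - 4 * v * w < 0 := by
  obtain ⟨h1, h2⟩ := re_im_of_equation h
  have hw' : (0 : ℝ) < w := by exact_mod_cast hw
  have : ((u : ℝ)) ^ 2 - 4 * v * w < 0 := by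
    have e : ((u : ℝ)) ^ 2 - 4 * v * w = -(2 * w * τ.im) ^ 2 := by
      rw [← h2, show (u : ℝ) = -(2 * w * τ.re) by linarith]
      ring
    rw [e]
    have := τ.im_pos
    have : 0 < (2 * w * τ.im) ^ 2 := by positivity
    linarith
  exact_mod_cast this

/-- The endomorphism ring of `E` is `ℤ + ℤ wτ`, and the square of the absolute value is the
quadratic form `x² + u x y + v w y²` on it. -/
theorem exists_int_of_endomorphism (hg : Int.gcd (Int.gcd u v) w = 1)
    (h : (w : ℂ) * (τ : ℂ) ^ 2 + u * (τ : ℂ) + v = 0) {z : ℂ}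
    (hz : ∀ x ∈ lattice τ, z * x ∈ lattice τ) :
    ∃ a b : ℤ, z = a - b * (w * τ) ∧
      (1 : ℝ) * a ^ 2 + u * a * b + v * w * b ^ 2 = Complex.normSq z := by
  obtain ⟨a, b, hab⟩ := mem_lattice_iff.1 (hz 1 (mem_lattice_iff.2 ⟨1, 0, by simp⟩))
  obtain ⟨p, r, hpr⟩ := mem_lattice_iff.1 (hz τ (mem_lattice_iff.2 ⟨0, 1, by simp⟩))
  rw [mul_one] at hab
  have e : ((-w * p - b * v : ℤ) : ℂ) + ((w * (a - r) - b * u : ℤ) : ℂ) * τ = 0 := by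
    rw [hab] at hpr
    push_cast
    linear_combination w * hpr - b * h
  obtain ⟨e1, e2⟩ := lattice_coord_eq_zero e
  have hwu : w ∣ b * u := ⟨a - r, by linarith⟩
  have hwv : w ∣ b * v := ⟨-p, by linarith⟩
  -- `w` divides `b u` and `b v`, and is coprime to `gcd(u, v)` by primitivity.
  have hwb : w ∣ b := by
    have h1 : w ∣ (Int.gcd (b * u) (b * v) : ℤ) := Int.dvd_coe_gcd hwu hwv
    rw [Int.gcd_mul_left] at h1
    push_cast at h1
    have h2 : IsCoprime w (Int.gcd u v : ℤ) := by
      rw [Int.isCoprime_iff_gcd_eq_one, Int.gcd_comm]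
      exact hg
    have h3 := h2.dvd_of_dvd_mul_right h1
    exact (dvd_abs _ _).1 h3
  obtain ⟨b', rfl⟩ := hwb
  -- The sign turns `-2 w Re τ = u` into the coefficient `+u` of `Q`.
  refine ⟨a, -b', ?_, ?_⟩
  · rw [hab]
    push_cast
    ring
  · obtain ⟨h1, h2⟩ := re_im_of_equation h
    rw [hab, ← h2, show (u : ℝ) = -(2 * w * τ.re) by linarith, Complex.normSq_apply]
    simp
    ring

end Equation

/-! ### Counting the curves -/

/-- Every degree is `m d₁ + n d₂` with `d₁ + d₂ ≥ 1`, hence at least `min m n`. -/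
theorem curvesOfDegreeLE_eq_empty {τ : ℍ} {m n : ℕ} {t : ℝ}
    (ht : t < (min m n : ℕ)) : curvesOfDegreeLE τ m n t = ∅ := by
  refine Set.eq_empty_of_forall_notMem fun F ⟨hF, hle⟩ => ?_
  obtain ⟨d₁, d₂, -, -, -, hpos, hdeg, -⟩ := hF.exists_degrees
  rw [hdeg] at hle
  have : min m n ≤ m * d₁ + n * d₂ := by
    calc min m n = min m n * 1 := (mul_one _).symm
      _ ≤ min m n * (d₁ + d₂) := Nat.mul_le_mul_left _ hpos
      _ ≤ m * d₁ + n * d₂ := by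
        rw [mul_add]
        gcongr
        · exact min_le_left _ _
        · exact min_le_right _ _
  have : ((min m n : ℕ) : ℝ) ≤ m * d₁ + n * d₂ := by exact_mod_cast this
  linarith

theorem exists_finset_of_not_hasCM {τ : ℍ} (hτ : ¬ HasCM τ) {m n : ℕ} (hm : 0 < m) (hn : 0 < n)
    {t : ℝ} (ht : 0 ≤ t) :
    ∃ G : Finset (AddSubgroup (Curve τ × Curve τ)), curvesOfDegreeLE τ m n t ⊆ G ∧
      (G.card : ℝ) ≤ ellipseArea m 0 n * t + ellipseLength m 0 n / 2 * √t + 1 := by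
  classical
  have hm' : (0 : ℝ) < m := by exact_mod_cast hm
  have hn' : (0 : ℝ) < n := by exact_mod_cast hn
  obtain ⟨T, hT, hcard⟩ := exists_finset_lattice_points (a := m) (b := 0) (c := n) hm'
    (by simp only [ne_eq, OfNat.ofNat_ne_zero, not_false_eq_true, zero_pow, sub_zero]; positivity)
    ht
  refine ⟨T.image fun p => lineImage τ (p.1, p.2), fun F ⟨hF, hle⟩ => ?_,
    le_trans (by exact_mod_cast Finset.card_image_le) hcard⟩
  obtain ⟨a, b, rfl, hab⟩ := hF.exists_int hτ
  simp only [Finset.coe_image, Set.mem_image, Finset.mem_coe]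
  refine ⟨(a, b), hT a b ?_, rfl⟩
  have := hab m n
  linarith

theorem four_le_ellipseLength_one (b c : ℝ) : 4 ≤ ellipseLength 1 b c := by
  simpa using le_ellipseLength 1 b c le_rfl (by positivity : (0 : ℝ) ≤ Real.pi / 2)

/-- A covering finite set gives finiteness along with the count, whereas `ncard` of an infinite set
is `0`. The term `k` collects one unit for each of the `k - 1` values of `d` and one for the curve
with `d₁ = 0`. -/
theorem exists_finset_of_equation {τ : ℍ} {u v w : ℤ} (hw : 0 < w)
    (hg : Int.gcd (Int.gcd u v) w = 1) (h : (w : ℂ) * (τ : ℂ) ^ 2 + u * (τ : ℂ) + v = 0)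
    {m n : ℕ} (hm : 0 < m) (hn : 0 < n) {t : ℝ} (ht : (min m n : ℕ) ≤ t) {k : ℕ}
    (hk : k = ⌊t / (min m n : ℕ)⌋₊) :
    ∃ G : Finset (AddSubgroup (Curve τ × Curve τ)), curvesOfDegreeLE τ m n t ⊆ G ∧
      (G.card : ℝ) ≤ ellipseArea 1 u (v * w) * ((k : ℝ) ^ 3 / 6 - (k : ℝ) / 6)
        + ellipseLength 1 u (v * w) / 2 *
          (Real.pi / 8 * (k : ℝ) ^ 2 - ((k : ℝ) - 2) / (6 * k)) + k := by
  classical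
  have hμ : (0 : ℝ) < (min m n : ℕ) := by exact_mod_cast lt_min hm hn
  have hk1 : 1 ≤ k := by
    rw [hk, Nat.one_le_floor_iff, one_le_div hμ]
    exact ht
  have hsum : ∀ (F : AddSubgroup (Curve τ × Curve τ)) (d₁ d₂ : ℕ), degree τ m n F ≤ t →
      degree τ m n F = m * d₁ + n * d₂ → d₁ + d₂ ≤ k := by
    intro F d₁ d₂ hle he
    rw [hk]
    apply Nat.le_floor
    rw [le_div_iff₀ hμ]
    have h1 : (d₁ + d₂) * min m n ≤ m * d₁ + n * d₂ := by
      rw [add_mul, mul_comm d₁, mul_comm d₂]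
      gcongr
      · exact min_le_left _ _
      · exact min_le_right _ _
    have h2 : ((d₁ + d₂ : ℕ) : ℝ) * (min m n : ℕ) ≤ m * d₁ + n * d₂ := by exact_mod_cast h1
    linarith
  have hL := four_le_ellipseLength_one u (v * w)
  -- For `k = 1` there is no `d` with `0 < d < k`, and only the two factors can occur. Here `-(k -
  -- 2) / (6 k) = 1 / 6`, and `L ≥ 4` makes the bound exceed `2`.
  rcases hk1.eq_or_lt with hk1 | hk2
  · refine ⟨{lineImage τ (0, 1), lineImage τ (1, 0)}, fun F ⟨hF, hle⟩ => ?_, ?_⟩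
    · obtain ⟨d₁, d₂, -, -, -, -, hdeg, h1, h2, -⟩ := hF.exists_degrees
      have := hsum F d₁ d₂ hle (hdeg m n)
      simp only [Finset.coe_insert, Finset.coe_singleton, Set.mem_insert_iff,
        Set.mem_singleton_iff]
      rcases Nat.eq_zero_or_pos d₁ with h0 | h0
      · exact Or.inl (h1 h0)
      · exact Or.inr (h2 (by omega))
    · have h2 : ((({lineImage τ (0, 1), lineImage τ (1, 0)} :
          Finset (AddSubgroup (Curve τ × Curve τ))).card : ℕ) : ℝ) ≤ 2 := by
        exact_mod_cast Finset.card_le_two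
      refine h2.trans ?_
      rw [← hk1]
      norm_num
      nlinarith [Real.pi_gt_three]
  · have hD : (0 : ℝ) < 4 * 1 * (v * w) - (u : ℝ) ^ 2 := by
      have : ((u ^ 2 - 4 * v * w : ℤ) : ℝ) < 0 := by exact_mod_cast discr_neg_of_equation hw h
      push_cast at this
      linarith
    have hex : ∀ d : ℕ, ∃ T : Finset (ℤ × ℤ), d ∈ Finset.Ico 1 k →
        (∀ x y : ℤ, (1 : ℝ) * x ^ 2 + u * x * y + v * w * y ^ 2 ≤ d * ((k : ℝ) - d) →
          (x, y) ∈ T) ∧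
        (T.card : ℝ) ≤ ellipseArea 1 u (v * w) * (d * ((k : ℝ) - d)) +
          ellipseLength 1 u (v * w) / 2 * √(d * ((k : ℝ) - d)) + 1 := by
      intro d
      by_cases hd : d ∈ Finset.Ico 1 k
      · have : (d : ℝ) ≤ k := by exact_mod_cast (Finset.mem_Ico.1 hd).2.le
        obtain ⟨T, hT⟩ := exists_finset_lattice_points (s := d * ((k : ℝ) - d)) one_pos hD
          (mul_nonneg d.cast_nonneg (by linarith))
        exact ⟨T, fun _ => hT⟩
      · exact ⟨∅, fun h => absurd h hd⟩
    choose T hT using hex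
    refine ⟨insert (lineImage τ (0, 1)) (((Finset.Ico 1 k).sigma T).image fun p =>
      lineImage τ (p.1, starRingEnd ℂ (p.2.1 - p.2.2 * (w * τ)))), fun F ⟨hF, hle⟩ => ?_, ?_⟩
    · obtain ⟨d₁, d₂, z, hz, hnorm, hpos, hdeg, h1, h2, h3⟩ := hF.exists_degrees
      have hdk := hsum F d₁ d₂ hle (hdeg m n)
      simp only [Finset.coe_insert, Finset.coe_image, Set.mem_insert_iff, Set.mem_image,
        Finset.mem_coe, Finset.mem_sigma]
      rcases Nat.eq_zero_or_pos d₁ with h0 | h0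
      · exact Or.inl (h1 h0)
      right
      rcases Nat.eq_zero_or_pos d₂ with h0' | h0'
      -- The curve with `d₂ = 0` costs nothing extra: it is the point `z = 0` already counted for `d
      -- = 1`.
      · have hmem : 1 ∈ Finset.Ico 1 k := by simp [hk2]
        refine ⟨⟨1, (0, 0)⟩, ⟨hmem, (hT 1 hmem).1 0 0 ?_⟩, ?_⟩
        · have : (1 : ℝ) ≤ k := by exact_mod_cast hk2.le
          simpa using this
        · rw [h2 h0']
          simp
      · have hmem : d₁ ∈ Finset.Ico 1 k := by
          rw [Finset.mem_Ico]
          omega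
        obtain ⟨a, b, rfl, hab⟩ := exists_int_of_endomorphism hg h hz
        refine ⟨⟨d₁, (a, b)⟩, ⟨hmem, (hT d₁ hmem).1 a b ?_⟩, (h3 h0.ne').symm⟩
        rw [hab, hnorm]
        have : (d₁ : ℝ) + d₂ ≤ k := by exact_mod_cast hdk
        exact mul_le_mul_of_nonneg_left (by linarith) d₁.cast_nonneg
    · have h1 : (insert (lineImage τ (0, 1)) (((Finset.Ico 1 k).sigma T).image fun p =>
          lineImage τ (p.1, starRingEnd ℂ (p.2.1 - p.2.2 * (w * τ))))).card ≤
          (∑ d ∈ Finset.Ico 1 k, (T d).card) + 1 :=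
        (Finset.card_insert_le _ _).trans (Nat.add_le_add_right
          (Finset.card_image_le.trans (Finset.card_sigma _ _).le) 1)
      have h2 : (((∑ d ∈ Finset.Ico 1 k, (T d).card) + 1 : ℕ) : ℝ) ≤
          ∑ d ∈ Finset.Ico 1 k, (ellipseArea 1 u (v * w) * (d * ((k : ℝ) - d)) +
            ellipseLength 1 u (v * w) / 2 * √(d * ((k : ℝ) - d)) + 1) + 1 := by
        push_cast
        gcongr with d hd
        exact (hT d hd).2
      refine (Nat.cast_le.2 h1).trans (h2.trans ?_)
      rw [Finset.sum_add_distrib, Finset.sum_add_distrib, ← Finset.mul_sum, ← Finset.mul_sum,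
        sum_mul_sub]
      have h3 := mul_le_mul_of_nonneg_left (sum_sqrt_mul_sub_le k hk2)
        (by linarith : 0 ≤ ellipseLength 1 u (v * w) / 2)
      have h4 : ∑ d ∈ Finset.Ico 1 k, (1 : ℝ) = k - 1 := by
        simp [Nat.cast_sub hk2.le]
      rw [h4]
      linarith

/-! ### Final estimates -/

theorem N_le_card {τ : ℍ} {m n : ℕ} {t : ℝ} {G : Finset (AddSubgroup (Curve τ × Curve τ))}
    (h : curvesOfDegreeLE τ m n t ⊆ G) : (N τ m n t : ℝ) ≤ G.card := by
  have := Set.ncard_le_ncard h G.finite_toSet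
  rw [Set.ncard_coe_finset] at this
  exact_mod_cast this

theorem ellipseArea_nonneg (a b c : ℝ) : 0 ≤ ellipseArea a b c :=
  div_nonneg Real.pi_pos.le (Real.sqrt_nonneg _)

theorem cubic_bound {A L μ t : ℝ} {k : ℕ} (hA : 0 ≤ A) (hL : 0 ≤ L) (hμ : 0 < μ) (hk : 1 ≤ k)
    (hkt : (k : ℝ) ≤ t / μ) :
    A * ((k : ℝ) ^ 3 / 6 - (k : ℝ) / 6)
        + L / 2 * (Real.pi / 8 * (k : ℝ) ^ 2 - ((k : ℝ) - 2) / (6 * k)) + k ≤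
      A / (6 * μ ^ 3) * t ^ 3 + (L * Real.pi / (16 * μ ^ 2) * t ^ 2 + t / μ + L / 12) := by
  have hk' : (1 : ℝ) ≤ k := by exact_mod_cast hk
  have h1 : (k : ℝ) ^ 3 / 6 - k / 6 ≤ (t / μ) ^ 3 / 6 := by
    have : (k : ℝ) ^ 3 ≤ (t / μ) ^ 3 := by gcongr
    linarith
  have h2 : Real.pi / 8 * (k : ℝ) ^ 2 - ((k : ℝ) - 2) / (6 * k) ≤
      Real.pi / 8 * (t / μ) ^ 2 + 1 / 6 := by
    have e1 : Real.pi / 8 * (k : ℝ) ^ 2 ≤ Real.pi / 8 * (t / μ) ^ 2 := by gcongr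
    -- The extreme case is `k = 1`; this is the origin of the constant `L / 12`.
    have e2 : -(1 / 6) ≤ ((k : ℝ) - 2) / (6 * k) := by
      rw [le_div_iff₀ (by linarith)]
      linarith
    linarith
  have h3 := mul_le_mul_of_nonneg_left h1 hA
  have h4 := mul_le_mul_of_nonneg_left h2 (by linarith : 0 ≤ L / 2)
  calc _ ≤ A * ((t / μ) ^ 3 / 6) + L / 2 * (Real.pi / 8 * (t / μ) ^ 2 + 1 / 6) + t / μ := by
        linarith
    _ = _ := by
      field_simp
      ring

theorem isBigO_sq_of_le {f : ℝ → ℝ} {a b c : ℝ} (hb : 0 ≤ b) (hc : 0 ≤ c)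
    (h0 : ∀ t, 1 ≤ t → 0 ≤ f t) (h : ∀ t, 1 ≤ t → f t ≤ a * t ^ 2 + b * t + c) :
    f =O[atTop] (fun t : ℝ => t ^ 2) := by
  apply IsBigO.of_bound (a + b + c)
  filter_upwards [eventually_ge_atTop 1] with t ht
  rw [Real.norm_of_nonneg (h0 t ht), Real.norm_of_nonneg (sq_nonneg t)]
  have h1 : t ≤ t ^ 2 := by nlinarith
  have h2 : 1 ≤ t ^ 2 := ht.trans h1
  nlinarith [h t ht, mul_le_mul_of_nonneg_left h1 hb, mul_le_mul_of_nonneg_left h2 hc]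

theorem finite_curvesOfDegreeLE {τ : ℍ} {m n : ℕ} (hm : 0 < m) (hn : 0 < n) (t : ℝ) :
    (curvesOfDegreeLE τ m n t).Finite := by
  rcases lt_or_ge t (min m n : ℕ) with ht | ht
  · rw [curvesOfDegreeLE_eq_empty ht]
    exact Set.finite_empty
  by_cases hτ : HasCM τ
  · obtain ⟨u, v, w, hw, hg, h⟩ := hτ.exists_equation
    obtain ⟨G, hG, -⟩ := exists_finset_of_equation hw hg h hm hn ht rfl
    exact G.finite_toSet.subset hG
  · obtain ⟨G, hG, -⟩ := exists_finset_of_not_hasCM hτ hm hn ((Nat.cast_nonneg _).trans ht)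
    exact G.finite_toSet.subset hG

end EllipticSquare

theorem proposition5p1 (τ : ℍ) (m n : ℕ) (hm : 0 < m) (hn : 0 < n) :
    (∀ t : ℝ, (EllipticSquare.curvesOfDegreeLE τ m n t).Finite) ∧
    ∃ (C : ℝ) (q : ℝ → ℝ),
      (∀ t : ℝ, 0 ≤ t → (EllipticSquare.N τ m n t : ℝ) ≤ C * t ^ 3 + q t) ∧
      q =O[atTop] (fun t : ℝ => t ^ 2) ∧
      (¬ EllipticSquare.HasCM τ →
        C = 0 ∧
        ∀ t : ℝ, q t = EllipticSquare.ellipseArea m 0 n * t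
          + EllipticSquare.ellipseLength m 0 n / 2 * √t + 1) ∧
      (EllipticSquare.HasCM τ →
        ∃ u v w : ℤ, 0 < w ∧ Int.gcd (Int.gcd u v) w = 1 ∧ u ^ 2 - 4 * v * w < 0 ∧
          (w : ℂ) * (τ : ℂ) ^ 2 + u * (τ : ℂ) + v = 0 ∧
          C = EllipticSquare.ellipseArea 1 u (v * w) / (6 * (min m n : ℕ) ^ 3) ∧
          (∀ t : ℝ, q t =
            EllipticSquare.ellipseLength 1 u (v * w) * Real.pi / (16 * (min m n : ℕ) ^ 2) * t ^ 2
              + t / (min m n : ℕ) + EllipticSquare.ellipseLength 1 u (v * w) / 12) ∧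
          (∀ (t : ℝ) (k : ℕ), (min m n : ℕ) ≤ t → k = ⌊t / (min m n : ℕ)⌋₊ →
            (EllipticSquare.N τ m n t : ℝ) ≤
              EllipticSquare.ellipseArea 1 u (v * w) * ((k : ℝ) ^ 3 / 6 - (k : ℝ) / 6)
                + EllipticSquare.ellipseLength 1 u (v * w) / 2
                  * (Real.pi / 8 * (k : ℝ) ^ 2 - ((k : ℝ) - 2) / (6 * k))
                + k)) := by
  open EllipticSquare in
  refine ⟨finite_curvesOfDegreeLE hm hn, ?_⟩
  by_cases hτ : HasCM τ
  · obtain ⟨u, v, w, hw, hg, h⟩ := hτ.exists_equation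
    have hμ : (0 : ℝ) < (min m n : ℕ) := by exact_mod_cast lt_min hm hn
    have hA := ellipseArea_nonneg 1 u (v * w)
    have hL := ellipseLength_nonneg 1 u (v * w)
    have hfine : ∀ (t : ℝ) (k : ℕ), (min m n : ℕ) ≤ t → k = ⌊t / (min m n : ℕ)⌋₊ →
        (N τ m n t : ℝ) ≤ ellipseArea 1 u (v * w) * ((k : ℝ) ^ 3 / 6 - (k : ℝ) / 6)
          + ellipseLength 1 u (v * w) / 2
            * (Real.pi / 8 * (k : ℝ) ^ 2 - ((k : ℝ) - 2) / (6 * k)) + k := by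
      intro t k ht hk
      obtain ⟨G, hG, hcard⟩ := exists_finset_of_equation hw hg h hm hn ht hk
      exact (N_le_card hG).trans hcard
    refine ⟨_, fun t => ellipseLength 1 u (v * w) * Real.pi / (16 * (min m n : ℕ) ^ 2) * t ^ 2
      + t / (min m n : ℕ) + ellipseLength 1 u (v * w) / 12, ?_, ?_, fun h => absurd hτ h,
      fun _ => ⟨u, v, w, hw, hg, discr_neg_of_equation hw h, h, rfl, fun _ => rfl, hfine⟩⟩
    · intro t ht
      rcases lt_or_ge t (min m n : ℕ) with htμ | htμ
      · rw [N, curvesOfDegreeLE_eq_empty htμ, Set.ncard_empty, Nat.cast_zero]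
        positivity
      · refine (hfine t _ htμ rfl).trans (cubic_bound hA hL hμ ?_ (Nat.floor_le (by positivity)))
        rw [Nat.one_le_floor_iff, one_le_div hμ]
        exact htμ
    · refine isBigO_sq_of_le
        (a := ellipseLength 1 u (v * w) * Real.pi / (16 * (min m n : ℕ) ^ 2))
        (b := 1 / (min m n : ℕ)) (c := ellipseLength 1 u (v * w) / 12)
        (by positivity) (by positivity) (fun t ht => by positivity)
        (fun t ht => le_of_eq (by ring))
  · have hA := ellipseArea_nonneg m 0 n
    have hL := ellipseLength_nonneg m 0 n
    refine ⟨0, fun t => ellipseArea m 0 n * t + ellipseLength m 0 n / 2 * √t + 1, ?_, ?_,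
      fun _ => ⟨rfl, fun _ => rfl⟩, fun h => absurd h hτ⟩
    · intro t ht
      obtain ⟨G, hG, hcard⟩ := exists_finset_of_not_hasCM hτ hm hn ht
      rw [zero_mul, zero_add]
      exact (N_le_card hG).trans hcard
    · refine isBigO_sq_of_le (a := 0) (b := ellipseArea m 0 n + ellipseLength m 0 n / 2) (c := 1)
        (by positivity) zero_le_one (fun t ht => by positivity) (fun t ht => ?_)
      have h1 : √t ≤ t := Real.sqrt_le_iff.2 ⟨by linarith, by nlinarith⟩
      have h2 := mul_le_mul_of_nonneg_left h1 (by linarith : 0 ≤ ellipseLength m 0 n / 2)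
      linarith
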